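/- Call a real random variable $x$ subgaussian with constant $L>0$ if $\Pr[|x|>t]\le 2\exp(-t^2/L^2)$ for all $t>0$, and a random vector $\mathbf x\in\mathbb R^d$ subgaussian with constant $L$ if $\langle \mathbf x,\mathbf y\rangle$ is subgaussian with constant $L$ for every unit vector $\mathbf y\in\mathbb R^d$. There is a function $\delta\mapsto\zeta(\delta)>0$ of $\delta>0$, and for every $L>0$ there are constants $c,c_0,c_0',c_1,C_1>0$ depending only on $L$, such that the following holds for all $n,d$. Let $\mathbf x_1,\dots,\mathbf x_n\in\mathbb R^d$ be independent (not necessarily identically distributed) random vectors that are centered ($\mathbb E[\mathbf x_i]=0$) and subgaussian with constant $L$. Let $a>0$, and let $K_g$ be the $n\times n$ matrix with $(i,j)$th entry $\exp(-a\|\mathbf x_i-\mathbf x_j\|^2)$; $\|K_g\|$ denotes its spectral norm. (a) $\|K_g\|\le n$ (always). (b) If $a<c_1/d$, then $\Pr[\|K_g\|\ge c_0 n]\ge 1-\exp(-c_0' n)$. (c) Assume in addition that each $\mathbf x_i$ has independent coordinates, that $\mathbb E\|\mathbf x_i-\mathbf x_j\|^2\ge d$ for all $i\ne j$ (which holds,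 for example, when all coordinates have unit variance), and that $n\le\exp(C_1 d)$. Then for every $\delta>0$ with $a\ge(2+\delta)\frac{\log n}{d}$, $\Pr[\|K_g\|\ge 2]\le\exp(-c\,\zeta(\delta)^2 d)$. -/

import Mathlib

open MeasureTheory ProbabilityTheory
open scoped Matrix.Norms.L2Operator

/-- A real random variable `X` is subgaussian with constant `L` if
`Pr[|X| > t] ≤ 2 exp(-t² / L²)` for all `t > 0`. -/
def IsSubgaussianWith {Ω : Type*} [MeasurableSpace Ω] (L : ℝ) (X : Ω → ℝ) (μ : Measure Ω) : Prop :=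
  ∀ t : ℝ, 0 < t → μ.real {ω | t < |X ω|} ≤ 2 * Real.exp (-t ^ 2 / L ^ 2)

/-- A random vector in `ℝᵈ` is subgaussian with constant `L` if all of its one-dimensional
marginals in directions of the unit sphere are subgaussian with constant `L`. -/
def IsSubgaussianVectorWith {Ω : Type*} [MeasurableSpace Ω] {d : ℕ} (L : ℝ)
    (X : Ω → EuclideanSpace ℝ (Fin d)) (μ : Measure Ω) : Prop :=
  ∀ y : EuclideanSpace ℝ (Fin d), ‖y‖ = 1 → IsSubgaussianWith L (fun ω => inner ℝ (X ω) y) μ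

/-- The Gaussian kernel matrix of the points `v 0, …, v (n - 1)`, with entries
`exp(-a ‖v i - v j‖²)`. Its norm `‖gaussianKernelMatrix a v‖` is the spectral norm (the operator
norm for the Euclidean norm). -/
noncomputable def gaussianKernelMatrix {n d : ℕ} (a : ℝ) (v : Fin n → EuclideanSpace ℝ (Fin d)) :
    Matrix (Fin n) (Fin n) ℝ :=
  Matrix.of fun i j => Real.exp (-a * ‖v i - v j‖ ^ 2)

/-! Both norm bounds are deterministic statements about the geometry of the points. Schur's test
bounds the norm by row sums: at most `n` always, and below 2 when every off-diagonal entry is at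
most `1 / n`. Testing against the indicator of a cluster of at least half the points gives a lower
bound of order `n`.

The probability enters only through a fourth-moment bound `M` on coordinates. For (b), Markov puts
each point in a ball of squared radius of order `d` with probability at least 5/6, and independence
makes at least half of them lie there except with probability `(3/4)^n`. For (c), a Chernoff bound
on the lower tail of a sum of nonnegative terms (`measureReal_norm_sub_sq_le`) separates each pair
by squared distance `d / 2`; a union bound over pairs finishes. -/

/-! ### Deterministic norm bounds -/

/-- Schur's test for a symmetric matrix with nonnegative entries. -/
theorem Matrix.l2_opNorm_le_of_sum_le {n : Type*} [Fintype n] [DecidableEq n] {A : Matrix n n ℝ}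
    {R : ℝ} (hR : 0 ≤ R) (hA : ∀ i j, 0 ≤ A i j) (hsymm : ∀ i j, A i j = A j i)
    (hsum : ∀ i, ∑ j, A i j ≤ R) : ‖A‖ ≤ R := by
  rw [← Matrix.l2_opNorm_toEuclideanCLM]
  refine ContinuousLinearMap.opNorm_le_bound _ hR fun v => ?_
  refine (sq_le_sq₀ (by positivity) (by positivity)).mp ?_
  rw [mul_pow, EuclideanSpace.norm_sq_eq, EuclideanSpace.norm_sq_eq]
  simp only [Matrix.ofLp_toEuclideanCLM, Real.norm_eq_abs, sq_abs]
  have key : ∀ i, (A.mulVec v.ofLp i) ^ 2 ≤ R * ∑ j, A i j * v j ^ 2 := by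
    intro i
    -- Cauchy–Schwarz with `A i j` split as `√(A i j) * √(A i j)`, so that one factor is the row
    -- sum.
    have h := Finset.sum_mul_sq_le_sq_mul_sq Finset.univ (fun j => √(A i j))
      (fun j => √(A i j) * v j)
    have e1 : ∀ j, √(A i j) * (√(A i j) * v j) = A i j * v j := fun j => by
      rw [← mul_assoc, Real.mul_self_sqrt (hA i j)]
    have e2 : ∀ j, (√(A i j) * v j) ^ 2 = A i j * v j ^ 2 := fun j => by
      rw [mul_pow, Real.sq_sqrt (hA i j)]
    simp only [e1, e2, Real.sq_sqrt (hA i _)] at h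
    calc (A.mulVec v.ofLp i) ^ 2 = (∑ j, A i j * v j) ^ 2 := rfl
      _ ≤ _ := h
      _ ≤ _ := mul_le_mul_of_nonneg_right (hsum i)
        (Finset.sum_nonneg fun j _ => mul_nonneg (hA i j) (sq_nonneg _))
  calc ∑ i, (A.mulVec v.ofLp i) ^ 2 ≤ ∑ i, R * ∑ j, A i j * v j ^ 2 :=
        Finset.sum_le_sum fun i _ => key i
    _ = R * ∑ j, (∑ i, A j i) * v j ^ 2 := by
        rw [← Finset.mul_sum, Finset.sum_comm]
        simp only [Finset.sum_mul, hsymm]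
    _ ≤ R * ∑ j, R * v j ^ 2 := by
        gcongr with j
        exact hsum j
    _ = R ^ 2 * ∑ j, v j ^ 2 := by rw [← Finset.mul_sum]; ring

/-- The sum of the entries of a square block is at most the spectral norm times the block size. -/
theorem Matrix.sum_sum_le_l2_opNorm_mul_card {n : Type*} [Fintype n] [DecidableEq n]
    (A : Matrix n n ℝ) (S : Finset n) : ∑ i ∈ S, ∑ j ∈ S, A i j ≤ ‖A‖ * S.card := by
  let v : EuclideanSpace ℝ n := WithLp.toLp 2 fun i => if i ∈ S then 1 else 0
  have hv : ‖v‖ ^ 2 = S.card := by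
    simp [v, EuclideanSpace.norm_sq_eq, ite_pow]
  have h1 : inner ℝ v (Matrix.toEuclideanCLM (n := n) (𝕜 := ℝ) A v)
      = ∑ i ∈ S, ∑ j ∈ S, A i j := by
    simp [v, PiLp.inner_apply, Matrix.mulVec, dotProduct, Finset.sum_ite_mem]
  rw [← h1, ← hv, pow_two, ← Matrix.l2_opNorm_toEuclideanCLM]
  calc _ ≤ ‖v‖ * ‖Matrix.toEuclideanCLM (n := n) (𝕜 := ℝ) A v‖ := real_inner_le_norm _ _
    _ ≤ ‖v‖ * (‖Matrix.toEuclideanCLM (n := n) (𝕜 := ℝ) A‖ * ‖v‖) := by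
        gcongr
        exact ContinuousLinearMap.le_opNorm _ _
    _ = _ := by ring

theorem gaussianKernelMatrix_apply {n d : ℕ} (a : ℝ) (v : Fin n → EuclideanSpace ℝ (Fin d))
    (i j : Fin n) : gaussianKernelMatrix a v i j = Real.exp (-a * ‖v i - v j‖ ^ 2) := rfl

theorem gaussianKernelMatrix_symm {n d : ℕ} (a : ℝ) (v : Fin n → EuclideanSpace ℝ (Fin d))
    (i j : Fin n) : gaussianKernelMatrix a v i j = gaussianKernelMatrix a v j i := by
  simp only [gaussianKernelMatrix_apply, norm_sub_rev]

theorem norm_gaussianKernelMatrix_le {n d : ℕ} {a : ℝ} (ha : 0 ≤ a)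
    (v : Fin n → EuclideanSpace ℝ (Fin d)) : ‖gaussianKernelMatrix a v‖ ≤ n := by
  refine Matrix.l2_opNorm_le_of_sum_le (Nat.cast_nonneg n) (fun i j => (Real.exp_pos _).le)
    (gaussianKernelMatrix_symm a v) fun i => ?_
  calc ∑ j, gaussianKernelMatrix a v i j ≤ ∑ _j : Fin n, (1 : ℝ) := by
        refine Finset.sum_le_sum fun j _ => Real.exp_le_one_iff.2 ?_
        have := sq_nonneg ‖v i - v j‖
        nlinarith
    _ = n := by simp

/-- If the points are pairwise far apart then the kernel matrix has norm less than two. -/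
theorem norm_gaussianKernelMatrix_lt_two {n d : ℕ} {a r : ℝ} (ha : 0 ≤ a)
    (v : Fin n → EuclideanSpace ℝ (Fin d)) (hv : ∀ i j, i ≠ j → r ≤ ‖v i - v j‖ ^ 2)
    (har : Real.log n ≤ a * r) : ‖gaussianKernelMatrix a v‖ < 2 := by
  rcases Nat.eq_zero_or_pos n with rfl | hn
  · have := norm_gaussianKernelMatrix_le ha v
    push_cast at this
    linarith
  have hn' : (0 : ℝ) < n := by exact_mod_cast hn
  -- A unit diagonal entry and `n - 1` entries of size at most `1 / n`; the slack gives strictness.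
  suffices ‖gaussianKernelMatrix a v‖ ≤ 2 - 1 / n by
    have : (0 : ℝ) < 1 / n := by positivity
    linarith
  have h1 : (1 : ℝ) / n ≤ 1 := by
    rw [div_le_one hn']; exact_mod_cast hn
  refine Matrix.l2_opNorm_le_of_sum_le (by linarith) (fun i j => (Real.exp_pos _).le)
    (gaussianKernelMatrix_symm a v) fun i => ?_
  calc ∑ j, gaussianKernelMatrix a v i j
      ≤ ∑ j, ((if i = j then 1 - 1 / (n : ℝ) else 0) + 1 / n) := by
        refine Finset.sum_le_sum fun j _ => ?_
        rw [gaussianKernelMatrix_apply]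
        split_ifs with h
        · simp [h]
        · have e : 1 / (n : ℝ) = Real.exp (-Real.log n) := by
            rw [Real.exp_neg, Real.exp_log hn', one_div]
          rw [zero_add, e, Real.exp_le_exp]
          have := mul_le_mul_of_nonneg_left (hv i j h) ha
          linarith
    _ = 2 - 1 / n := by
        rw [Finset.sum_add_distrib]
        simp
        field_simp
        ring

/-- If at least half of the points are in a ball, then the kernel matrix has norm of order `n`. -/
theorem le_norm_gaussianKernelMatrix {n d : ℕ} {a r : ℝ} (ha : 0 ≤ a)
    (v : Fin n → EuclideanSpace ℝ (Fin d)) (S : Finset (Fin n)) (hS : (n : ℝ) ≤ 2 * S.card)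
    (hr : ∀ i ∈ S, ‖v i‖ ^ 2 ≤ r) (har : a * (4 * r) ≤ 1) :
    Real.exp (-1) / 2 * n ≤ ‖gaussianKernelMatrix a v‖ := by
  rcases S.eq_empty_or_nonempty with rfl | hne
  · have : (n : ℝ) = 0 := le_antisymm (by simpa using hS) (Nat.cast_nonneg n)
    simp [this]
  have hpos : (0 : ℝ) < S.card := by exact_mod_cast hne.card_pos
  have h := Matrix.sum_sum_le_l2_opNorm_mul_card (gaussianKernelMatrix a v) S
  have h2 : ∑ i ∈ S, ∑ j ∈ S, Real.exp (-1) ≤ ∑ i ∈ S, ∑ j ∈ S, gaussianKernelMatrix a v i j := by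
    refine Finset.sum_le_sum fun i hi => Finset.sum_le_sum fun j hj => Real.exp_le_exp.2 ?_
    have h3 : ‖v i - v j‖ ^ 2 ≤ 4 * r := by
      have h4 := norm_sub_le (v i) (v j)
      have h5 := hr i hi
      have h6 := hr j hj
      have h7 : ‖v i - v j‖ ^ 2 ≤ (‖v i‖ + ‖v j‖) ^ 2 := by gcongr
      nlinarith [sq_nonneg (‖v i‖ - ‖v j‖)]
    nlinarith
  simp only [Finset.sum_const, nsmul_eq_mul] at h2
  have h3 : (S.card : ℝ) * Real.exp (-1) ≤ ‖gaussianKernelMatrix a v‖ := by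
    have := h2.trans h
    rw [mul_comm] at this
    exact le_of_mul_le_mul_right this hpos
  have := Real.exp_pos (-1)
  nlinarith

/-! ### Moments of subgaussian coordinates -/

/-- Subgaussian variables with a given constant have uniformly bounded fourth moments. -/
theorem exists_integral_pow_four_le {L : ℝ} (hL : 0 < L) :
    ∃ M : ℝ, 0 < M ∧ ∀ {Ω : Type*} [MeasurableSpace Ω] (μ : Measure Ω) [IsProbabilityMeasure μ]
      (X : Ω → ℝ), Measurable X → IsSubgaussianWith L X μ →
      Integrable (fun ω => X ω ^ 4) μ ∧ ∫ ω, X ω ^ 4 ∂μ ≤ M := by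
  -- Layer-cake integrand for the fourth moment, with the tail replaced by its subgaussian bound.
  set F : ℝ → ℝ := fun t => 2 * (t ^ (3 : ℝ) * Real.exp (-(1 / L ^ 2) * t ^ 2)) with hF
  set I : ENNReal := ENNReal.ofReal 4 * ∫⁻ t in Set.Ioi (0 : ℝ), ENNReal.ofReal (F t) with hI
  have hfin : I ≠ ⊤ := by
    have hint : Integrable F :=
      (integrable_rpow_mul_exp_neg_mul_sq (b := 1 / L ^ 2) (by positivity) (s := 3)
        (by norm_num)).const_mul 2
    refine ENNReal.mul_ne_top ENNReal.ofReal_ne_top ?_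
    exact (hint.integrableOn (s := Set.Ioi 0)).lintegral_lt_top.ne
  refine ⟨I.toReal + 1, by positivity, fun μ _ X hX hsub => ?_⟩
  have hle : ∫⁻ ω, ENNReal.ofReal (X ω ^ 4) ∂μ ≤ I := by
    have h := lintegral_rpow_eq_lintegral_meas_lt_mul μ (f := fun ω => |X ω|)
      (Filter.Eventually.of_forall fun ω => abs_nonneg _) hX.abs.aemeasurable (p := 4) (by norm_num)
    have e : ∀ ω, |X ω| ^ (4 : ℝ) = X ω ^ 4 := fun ω => by
      rw [show (4 : ℝ) = ((4 : ℕ) : ℝ) by norm_num, Real.rpow_natCast]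
      exact (by decide : Even 4).pow_abs _
    simp only [e] at h
    rw [h, hI]
    refine mul_le_mul_right ?_ _
    refine setLIntegral_mono' measurableSet_Ioi fun t ht => ?_
    have ht' : 0 < t := ht
    have h1 : μ {ω | t < |X ω|} ≤ ENNReal.ofReal (2 * Real.exp (-t ^ 2 / L ^ 2)) := by
      rw [← ofReal_measureReal]
      exact ENNReal.ofReal_le_ofReal (hsub t ht')
    calc _ ≤ ENNReal.ofReal (2 * Real.exp (-t ^ 2 / L ^ 2)) * ENNReal.ofReal (t ^ ((4 : ℝ) - 1)) := by
          gcongr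
      _ = ENNReal.ofReal (F t) := by
          rw [← ENNReal.ofReal_mul (by positivity)]
          congr 1
          simp only [hF]
          rw [show (4 : ℝ) - 1 = 3 by norm_num,
            show -t ^ 2 / L ^ 2 = -(1 / L ^ 2) * t ^ 2 by ring]
          ring
  have hnn : 0 ≤ᵐ[μ] fun ω => X ω ^ 4 := Filter.Eventually.of_forall fun ω => by positivity
  have hmeas : AEStronglyMeasurable (fun ω => X ω ^ 4) μ := (hX.pow_const 4).aestronglyMeasurable
  refine ⟨⟨hmeas, ?_⟩, ?_⟩
  · rw [hasFiniteIntegral_iff_ofReal hnn]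
    exact lt_of_le_of_lt hle hfin.lt_top
  · rw [integral_eq_lintegral_of_nonneg_ae hnn hmeas]
    have := ENNReal.toReal_mono hfin hle
    linarith

theorem Integrable.sq_of_pow_four {Ω : Type*} [MeasurableSpace Ω] {μ : Measure Ω}
    [IsProbabilityMeasure μ] {X : Ω → ℝ} (hX : Measurable X)
    (h4 : Integrable (fun ω => X ω ^ 4) μ) : Integrable (fun ω => X ω ^ 2) μ := by
  refine ((integrable_const (1 : ℝ)).add h4).mono' (hX.pow_const 2).aestronglyMeasurable
    (Filter.Eventually.of_forall fun ω => ?_)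
  simp only [Pi.add_apply, Real.norm_eq_abs, abs_of_nonneg (sq_nonneg (X ω))]
  nlinarith [sq_nonneg (X ω ^ 2 - 1), sq_nonneg (X ω)]

theorem integral_sq_le_one_add {Ω : Type*} [MeasurableSpace Ω] {μ : Measure Ω}
    [IsProbabilityMeasure μ] {X : Ω → ℝ} (hX : Measurable X)
    (h4 : Integrable (fun ω => X ω ^ 4) μ) : ∫ ω, X ω ^ 2 ∂μ ≤ 1 + ∫ ω, X ω ^ 4 ∂μ := by
  have h : ∫ ω, (1 + X ω ^ 4) ∂μ = 1 + ∫ ω, X ω ^ 4 ∂μ := by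
    rw [integral_add (integrable_const _) h4]; simp
  rw [← h]
  refine integral_mono (Integrable.sq_of_pow_four hX h4) ((integrable_const _).add h4) fun ω => ?_
  nlinarith [sq_nonneg (X ω ^ 2 - 1), sq_nonneg (X ω)]

theorem IsSubgaussianVectorWith.coord {Ω : Type*} [MeasurableSpace Ω] {μ : Measure Ω} {d : ℕ}
    {L : ℝ} {X : Ω → EuclideanSpace ℝ (Fin d)} (h : IsSubgaussianVectorWith L X μ) (k : Fin d) :
    IsSubgaussianWith L (fun ω => X ω k) μ := by
  have := h (EuclideanSpace.single k 1) (by simp)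
  simpa [EuclideanSpace.inner_single_right] using this

/-- Follows from `1 + y + y²/2 ≤ exp y` and `(1 + y + y²/2)(1 - y + y²/2) = 1 + y⁴/4`. -/
theorem Real.exp_neg_le_one_sub_add_sq_half {y : ℝ} (hy : 0 ≤ y) :
    Real.exp (-y) ≤ 1 - y + y ^ 2 / 2 := by
  have h := Real.quadratic_le_exp_of_nonneg hy
  rw [Real.exp_neg, inv_le_comm₀ (Real.exp_pos _) (by nlinarith [sq_nonneg (y - 1)])]
  refine le_trans ?_ h
  rw [inv_le_iff_one_le_mul₀ (by nlinarith [sq_nonneg (y - 1)])]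
  nlinarith [sq_nonneg (y ^ 2)]

/-! ### Lower tail of pairwise distances -/

/-- Fubini's theorem for a bounded function of two independent random variables. -/
theorem ProbabilityTheory.IndepFun.integral_comp_prodMk {Ω E F : Type*} [MeasurableSpace Ω]
    [MeasurableSpace E] [MeasurableSpace F] {μ : Measure Ω} [IsProbabilityMeasure μ]
    {X : Ω → E} {Y : Ω → F} (hX : Measurable X) (hY : Measurable Y) (h : IndepFun X Y μ)
    {G : E × F → ℝ} (hG : Measurable G) {C : ℝ} (hC : ∀ p, |G p| ≤ C) :
    ∫ ω, G (X ω, Y ω) ∂μ = ∫ ω', ∫ ω, G (X ω, Y ω') ∂μ ∂μ := by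
  have := Measure.isProbabilityMeasure_map (μ := μ) hX.aemeasurable
  have := Measure.isProbabilityMeasure_map (μ := μ) hY.aemeasurable
  have e := (indepFun_iff_map_prod_eq_prod_map_map hX.aemeasurable hY.aemeasurable).1 h
  rw [← integral_map (φ := fun ω => (X ω, Y ω)) (hX.prodMk hY).aemeasurable
    hG.aestronglyMeasurable, e, integral_prod_symm]
  · rw [integral_map hY.aemeasurable]
    · congr 1
      ext ω'
      rw [integral_map hX.aemeasurable]
      exact (hG.comp measurable_prodMk_right).aestronglyMeasurable
    · exact (hG.stronglyMeasurable.integral_prod_left').aestronglyMeasurable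
  · exact Integrable.of_bound hG.aestronglyMeasurable C (Filter.Eventually.of_forall hC)

/-- Freeze `Y`: the integral over `X` factors into functions of single coordinates of `Y`, whose
product factors in turn. -/
theorem ProbabilityTheory.IndepFun.integral_prod_comp_sub {Ω ι : Type*} [MeasurableSpace Ω]
    [Fintype ι] {μ : Measure Ω} [IsProbabilityMeasure μ] {X Y : Ω → EuclideanSpace ℝ ι}
    (hX : Measurable X) (hY : Measurable Y) (h : IndepFun X Y μ)
    (hXi : iIndepFun (fun k ω => X ω k) μ) (hYi : iIndepFun (fun k ω => Y ω k) μ)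
    {g : ℝ → ℝ} (hg : Measurable g) (h0 : ∀ t, 0 ≤ g t) (h1 : ∀ t, g t ≤ 1) :
    ∫ ω, ∏ k, g (X ω k - Y ω k) ∂μ = ∏ k, ∫ ω, g (X ω k - Y ω k) ∂μ := by
  have hXk : ∀ k, Measurable fun ω => X ω k := fun k => by fun_prop
  have hYk : ∀ k, Measurable fun ω => Y ω k := fun k => by fun_prop
  rw [h.integral_comp_prodMk hX hY (G := fun p => ∏ k, g (p.1 k - p.2 k)) (C := 1)]
  · have e : ∀ ω', ∫ ω, ∏ k, g (X ω k - Y ω' k) ∂μ = ∏ k, ∫ ω, g (X ω k - Y ω' k) ∂μ := fun ω' =>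
      hXi.integral_fun_prod_comp (f := fun k t => g (t - Y ω' k)) (fun k => (hXk k).aemeasurable)
        fun k => (hg.comp (measurable_id.sub_const _)).aestronglyMeasurable
    simp only [e]
    rw [hYi.integral_fun_prod_comp (f := fun k t => ∫ ω, g (X ω k - t) ∂μ)
      (fun k => (hYk k).aemeasurable)]
    · refine Finset.prod_congr rfl fun k _ => ?_
      have hk : IndepFun (fun ω => X ω k) (fun ω => Y ω k) μ :=
        h.comp (φ := fun v : EuclideanSpace ℝ ι => v k) (ψ := fun v : EuclideanSpace ℝ ι => v k)
          (by fun_prop) (by fun_prop)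
      exact (hk.integral_comp_prodMk (hXk k) (hYk k) (G := fun p => g (p.1 - p.2)) (C := 1)
        (by fun_prop) fun p => by rw [abs_of_nonneg (h0 _)]; exact h1 _).symm
    · intro k
      have : StronglyMeasurable fun p : ℝ × Ω => g (X p.2 k - p.1) :=
        (hg.comp (((hXk k).comp measurable_snd).sub measurable_fst)).stronglyMeasurable
      exact this.integral_prod_right'.aestronglyMeasurable
  · fun_prop
  · intro p
    rw [abs_of_nonneg (Finset.prod_nonneg fun k _ => h0 _)]
    exact Finset.prod_le_one (fun k _ => h0 _) fun k _ => h1 _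

/-- For a nonnegative variable, the Laplace transform at negative arguments is controlled by two
moments alone. -/
theorem integral_exp_neg_mul_le {Ω : Type*} [MeasurableSpace Ω] {μ : Measure Ω}
    [IsProbabilityMeasure μ] {Z : Ω → ℝ} (h0 : ∀ ω, 0 ≤ Z ω)
    (h1 : Integrable Z μ) (h2 : Integrable (fun ω => Z ω ^ 2) μ) {C l : ℝ} (hl : 0 ≤ l)
    (hC : ∫ ω, Z ω ^ 2 ∂μ ≤ C) :
    ∫ ω, Real.exp (-l * Z ω) ∂μ ≤ Real.exp (-l * ∫ ω, Z ω ∂μ + l ^ 2 * C / 2) := by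
  have hi : Integrable (fun ω => 1 - l * Z ω + l ^ 2 / 2 * Z ω ^ 2) μ :=
    ((integrable_const _).sub (h1.const_mul l)).add (h2.const_mul _)
  have hb : ∫ ω, Real.exp (-l * Z ω) ∂μ ≤ ∫ ω, (1 - l * Z ω + l ^ 2 / 2 * Z ω ^ 2) ∂μ := by
    refine integral_mono_of_nonneg (Filter.Eventually.of_forall fun ω => (Real.exp_pos _).le) hi
      (Filter.Eventually.of_forall fun ω => ?_)
    have := Real.exp_neg_le_one_sub_add_sq_half (mul_nonneg hl (h0 ω))
    simp only [neg_mul]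
    linarith [mul_pow l (Z ω) 2]
  rw [integral_add (f := fun ω => 1 - l * Z ω) ((integrable_const _).sub (h1.const_mul l))
    (h2.const_mul _), integral_sub (integrable_const _) (h1.const_mul l), integral_const_mul,
    integral_const_mul] at hb
  simp only [integral_const, probReal_univ, one_smul] at hb
  have h3 := Real.add_one_le_exp (-l * ∫ ω, Z ω ∂μ + l ^ 2 * C / 2)
  have h4 := mul_le_mul_of_nonneg_left hC (by positivity : 0 ≤ l ^ 2 / 2)
  linarith

/-- Lower tail of the squared distance of two independent vectors with independent coordinates. -/
theorem measureReal_norm_sub_sq_le {Ω : Type*} [MeasurableSpace Ω] {μ : Measure Ω}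
    [IsProbabilityMeasure μ] {d : ℕ} {M : ℝ} (hM : 0 < M) {X Y : Ω → EuclideanSpace ℝ (Fin d)}
    (hX : Measurable X) (hY : Measurable Y) (h : IndepFun X Y μ)
    (hXi : iIndepFun (fun k ω => X ω k) μ) (hYi : iIndepFun (fun k ω => Y ω k) μ)
    (hX4 : ∀ k, Integrable (fun ω => X ω k ^ 4) μ ∧ ∫ ω, X ω k ^ 4 ∂μ ≤ M)
    (hY4 : ∀ k, Integrable (fun ω => Y ω k ^ 4) μ ∧ ∫ ω, Y ω k ^ 4 ∂μ ≤ M)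
    (hd : (d : ℝ) ≤ ∫ ω, ‖X ω - Y ω‖ ^ 2 ∂μ) :
    μ.real {ω | ‖X ω - Y ω‖ ^ 2 ≤ d / 2} ≤ Real.exp (-d / (128 * M)) := by
  set Z : Fin d → Ω → ℝ := fun k ω => (X ω k - Y ω k) ^ 2 with hZdef
  have hZm : ∀ k, Measurable (Z k) := fun k => by fun_prop
  have hns : ∀ ω, ‖X ω - Y ω‖ ^ 2 = ∑ k, Z k ω := fun ω => by
    simp [EuclideanSpace.norm_sq_eq, hZdef]
  have hD4 : ∀ k, Integrable (fun ω => 8 * (X ω k ^ 4 + Y ω k ^ 4)) μ := fun k =>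
    ((hX4 k).1.add (hY4 k).1).const_mul 8
  have hZ2le : ∀ k ω, Z k ω ^ 2 ≤ 8 * (X ω k ^ 4 + Y ω k ^ 4) := fun k ω => by
    have : ∀ u v : ℝ, ((u - v) ^ 2) ^ 2 ≤ 8 * (u ^ 4 + v ^ 4) := fun u v => by
      have h1 : (u - v) ^ 2 ≤ 2 * (u ^ 2 + v ^ 2) := by nlinarith [sq_nonneg (u + v)]
      have h2 : ((u - v) ^ 2) ^ 2 ≤ (2 * (u ^ 2 + v ^ 2)) ^ 2 := by gcongr
      nlinarith [sq_nonneg (u ^ 2 - v ^ 2)]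
    exact this _ _
  have hZ2 : ∀ k, Integrable (fun ω => Z k ω ^ 2) μ := fun k =>
    (hD4 k).mono' ((hZm k).pow_const 2).aestronglyMeasurable
      (Filter.Eventually.of_forall fun ω => by
        rw [Real.norm_eq_abs, abs_of_nonneg (sq_nonneg _)]; exact hZ2le k ω)
  have hZ2int : ∀ k, ∫ ω, Z k ω ^ 2 ∂μ ≤ 16 * M := fun k => by
    refine (integral_mono (hZ2 k) (hD4 k) (hZ2le k)).trans ?_
    rw [integral_const_mul, integral_add (hX4 k).1 (hY4 k).1]
    linarith [(hX4 k).2, (hY4 k).2]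
  have hZ1 : ∀ k, Integrable (Z k) μ := fun k =>
    Integrable.sq_of_pow_four (X := fun ω => X ω k - Y ω k) (by fun_prop) (by
      have := hZ2 k
      simp only [hZdef, ← pow_mul] at this
      exact this)
  have hsum : (d : ℝ) ≤ ∑ k, ∫ ω, Z k ω ∂μ := by
    rw [← integral_finsetSum _ fun k _ => hZ1 k]
    simpa only [hns] using hd
  -- Maximizes the Chernoff exponent `l / 2 - 8 * M * l ^ 2` per dimension, with value `1 / (128 *
  -- M)`.
  set l : ℝ := 1 / (32 * M) with hl
  have hl0 : 0 < l := by positivity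
  have hmgf : mgf (fun ω => ‖X ω - Y ω‖ ^ 2) μ (-l)
      ≤ Real.exp (-l * d + l ^ 2 * (16 * M) / 2 * d) := by
    have e : ∀ ω, Real.exp (-l * ‖X ω - Y ω‖ ^ 2)
        = ∏ k, Real.exp (-l * (X ω k - Y ω k) ^ 2) := fun ω => by
      rw [hns, Finset.mul_sum, Real.exp_sum]
    simp only [mgf, e]
    rw [h.integral_prod_comp_sub hX hY hXi hYi (g := fun t => Real.exp (-l * t ^ 2))
      (by fun_prop) (fun t => (Real.exp_pos _).le)
      fun t => Real.exp_le_one_iff.2 (by nlinarith [sq_nonneg t])]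
    calc _ ≤ ∏ k, Real.exp (-l * ∫ ω, Z k ω ∂μ + l ^ 2 * (16 * M) / 2) :=
          Finset.prod_le_prod (fun k _ => integral_nonneg fun ω => (Real.exp_pos _).le) fun k _ =>
            integral_exp_neg_mul_le (fun ω => sq_nonneg _) (hZ1 k) (hZ2 k) hl0.le
              (hZ2int k)
      _ ≤ _ := by
          rw [← Real.exp_sum, Real.exp_le_exp, Finset.sum_add_distrib, ← Finset.mul_sum]
          simp only [Finset.sum_const, Finset.card_univ, Fintype.card_fin, nsmul_eq_mul]
          have := mul_le_mul_of_nonneg_left hsum hl0.le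
          linarith
  have hint : Integrable (fun ω => Real.exp (-l * ‖X ω - Y ω‖ ^ 2)) μ :=
    Integrable.of_bound (by fun_prop) 1 (Filter.Eventually.of_forall fun ω => by
      rw [Real.norm_eq_abs, Real.abs_exp, Real.exp_le_one_iff]
      nlinarith [sq_nonneg ‖X ω - Y ω‖])
  refine (measure_le_le_exp_mul_mgf (d / 2) (by linarith : -l ≤ 0) hint).trans ?_
  refine (mul_le_mul_of_nonneg_left hmgf (Real.exp_pos _).le).trans ?_
  rw [← Real.exp_add, Real.exp_le_exp, hl]
  apply le_of_eq
  field_simp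
  ring

/-! ### Concentration of points in a ball -/

/-- With overwhelming probability, at least half of the independent vectors lie in a ball which
contains each of them with probability at least `5 / 6`. -/
theorem measureReal_card_lt_le {Ω E : Type*} [MeasurableSpace Ω] [MeasurableSpace E]
    {μ : Measure Ω} [IsProbabilityMeasure μ] {n : ℕ} {x : Fin n → Ω → E}
    (hx : ∀ i, Measurable (x i)) (hind : iIndepFun x μ) {B : Set E} [DecidablePred (· ∈ B)]
    (hB : MeasurableSet B) (hp : ∀ i, μ.real {ω | x i ω ∉ B} ≤ 1 / 6) :
    μ.real {ω | (2 * (Finset.univ.filter fun i => x i ω ∈ B).card : ℝ) < n} ≤ (3 / 4) ^ n := by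
  -- Exponential Markov: each factor has mean at most `1 + 3/6 = 3/2`, while more than `n / 2`
  -- points outside `B` force the product to be at least `4^(n/2) = 2^n`.
  set f : E → ℝ := fun v => if v ∈ B then 1 else 4 with hf
  have hfm : Measurable f := Measurable.ite hB measurable_const measurable_const
  have hf1 : ∀ v, 1 ≤ f v := fun v => by simp only [hf]; split_ifs <;> norm_num
  have hf4 : ∀ v, f v ≤ 4 := fun v => by simp only [hf]; split_ifs <;> norm_num
  have hfi : ∀ i, ∫ ω, f (x i ω) ∂μ ≤ 3 / 2 := fun i => by
    have hms : MeasurableSet {ω | x i ω ∉ B} := (hx i hB).compl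
    have e : ∀ ω, f (x i ω) = 1 + Set.indicator {ω | x i ω ∉ B} (fun _ => (3 : ℝ)) ω := fun ω => by
      by_cases hω : x i ω ∈ B <;> simp [hf, hω]; norm_num
    simp only [e]
    rw [integral_add (integrable_const _) ((integrable_const _).indicator hms),
      integral_indicator_const _ hms]
    simp only [integral_const, probReal_univ, smul_eq_mul]
    linarith [hp i]
  have hprod : ∫ ω, ∏ i, f (x i ω) ∂μ ≤ (3 / 2) ^ n := by
    rw [hind.integral_fun_prod_comp (f := fun _ => f) (fun i => (hx i).aemeasurable)
      fun i => hfm.aestronglyMeasurable]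
    calc _ ≤ ∏ _i : Fin n, (3 / 2 : ℝ) :=
          Finset.prod_le_prod (fun i _ => integral_nonneg fun ω => zero_le_one.trans (hf1 _))
            fun i _ => hfi i
      _ = _ := by rw [Finset.prod_const, Finset.card_univ, Fintype.card_fin]
  have hP0 : ∀ ω, 0 ≤ ∏ i, f (x i ω) := fun ω =>
    Finset.prod_nonneg fun i _ => zero_le_one.trans (hf1 _)
  have hint : Integrable (fun ω => ∏ i, f (x i ω)) μ := by
    refine Integrable.of_bound (C := 4 ^ n)
      (Finset.measurable_fun_prod _ fun i _ => hfm.comp (hx i)).aestronglyMeasurable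
      (Filter.Eventually.of_forall fun ω => ?_)
    rw [Real.norm_eq_abs, abs_of_nonneg (hP0 ω)]
    calc _ ≤ ∏ _i : Fin n, (4 : ℝ) :=
          Finset.prod_le_prod (fun i _ => zero_le_one.trans (hf1 _)) fun i _ => hf4 _
      _ = _ := by simp
  have hsub : {ω | (2 * (Finset.univ.filter fun i => x i ω ∈ B).card : ℝ) < n}
      ⊆ {ω | (2 : ℝ) ^ n ≤ ∏ i, f (x i ω)} := by
    intro ω hω
    simp only [Set.mem_ofPred_eq] at hω ⊢
    have hc : (Finset.univ.filter fun i => x i ω ∈ B).card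
        + (Finset.univ.filter fun i => ¬ x i ω ∈ B).card = n := by
      rw [Finset.card_filter_add_card_filter_not]; simp
    have hω' : 2 * (Finset.univ.filter fun i => x i ω ∈ B).card < n := by exact_mod_cast hω
    simp only [hf]
    rw [Finset.prod_ite]
    simp only [Finset.prod_const, one_pow, one_mul]
    rw [show (4 : ℝ) = 2 ^ 2 by norm_num, ← pow_mul]
    exact pow_le_pow_right₀ (by norm_num) (by omega)
  refine (measureReal_mono hsub).trans ?_
  have hm := mul_meas_ge_le_integral_of_nonneg (Filter.Eventually.of_forall hP0) hint ((2 : ℝ) ^ n)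
  have h2 : (0 : ℝ) < 2 ^ n := by positivity
  have h3 : (3 / 4 : ℝ) ^ n * 2 ^ n = (3 / 2) ^ n := by rw [← mul_pow]; norm_num
  refine le_of_mul_le_mul_right ?_ h2
  rw [h3, mul_comm]
  exact hm.trans hprod

theorem measureReal_lt_norm_sq_le {Ω : Type*} [MeasurableSpace Ω] {μ : Measure Ω}
    [IsProbabilityMeasure μ] {d : ℕ} (hd : 0 < d) {M : ℝ} (hM : 0 < M)
    {X : Ω → EuclideanSpace ℝ (Fin d)} (hX : Measurable X)
    (hX4 : ∀ k, Integrable (fun ω => X ω k ^ 4) μ ∧ ∫ ω, X ω k ^ 4 ∂μ ≤ M) :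
    μ.real {ω | 6 * (1 + M) * d < ‖X ω‖ ^ 2} ≤ 1 / 6 := by
  have hns : ∀ ω, ‖X ω‖ ^ 2 = ∑ k, X ω k ^ 2 := fun ω => by
    simp [EuclideanSpace.norm_sq_eq]
  have hi : ∀ k, Integrable (fun ω => X ω k ^ 2) μ := fun k =>
    Integrable.sq_of_pow_four (by fun_prop) (hX4 k).1
  have hint : Integrable (fun ω => ‖X ω‖ ^ 2) μ := by
    simp only [hns]; exact integrable_finsetSum _ fun k _ => hi k
  have hle : ∫ ω, ‖X ω‖ ^ 2 ∂μ ≤ (1 + M) * d := by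
    simp only [hns]
    rw [integral_finsetSum _ fun k _ => hi k]
    calc _ ≤ ∑ _k : Fin d, (1 + M) := Finset.sum_le_sum fun k _ =>
          (integral_sq_le_one_add (by fun_prop) (hX4 k).1).trans (by linarith [(hX4 k).2])
      _ = _ := by rw [Finset.sum_const, Finset.card_univ, Fintype.card_fin, nsmul_eq_mul, mul_comm]
  have hm := mul_meas_ge_le_integral_of_nonneg
    (Filter.Eventually.of_forall fun ω => sq_nonneg ‖X ω‖) hint (6 * (1 + M) * d)
  have hsub : μ.real {ω | 6 * (1 + M) * d < ‖X ω‖ ^ 2}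
      ≤ μ.real {ω | 6 * (1 + M) * d ≤ ‖X ω‖ ^ 2} :=
    measureReal_mono fun ω hω => by
      rw [Set.mem_ofPred_eq] at hω ⊢
      exact hω.le
  have hpos : 0 < (1 + M) * (d : ℝ) := by positivity
  refine hsub.trans (le_of_mul_le_mul_left ?_ hpos)
  linarith [hm.trans hle]

/-! ### Probabilistic norm bounds and conclusion -/

/-- The kernel matrix has norm of order `n` when the scale `a` is of order `1 / d`. -/
theorem measureReal_le_norm_gaussianKernelMatrix {Ω : Type*} [MeasurableSpace Ω] {μ : Measure Ω}
    [IsProbabilityMeasure μ] {n d : ℕ} (hd : 0 < d) {M a : ℝ} (hM : 0 < M) (ha : 0 ≤ a)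
    {x : Fin n → Ω → EuclideanSpace ℝ (Fin d)} (hx : ∀ i, Measurable (x i)) (hind : iIndepFun x μ)
    (hx4 : ∀ i k, Integrable (fun ω => x i ω k ^ 4) μ ∧ ∫ ω, x i ω k ^ 4 ∂μ ≤ M)
    (had : a * (24 * (1 + M) * d) ≤ 1) :
    1 - (3 / 4) ^ n ≤
      μ.real {ω | Real.exp (-1) / 2 * n ≤ ‖gaussianKernelMatrix a (fun i => x i ω)‖} := by
  classical
  set B : Set (EuclideanSpace ℝ (Fin d)) := {v | ‖v‖ ^ 2 ≤ 6 * (1 + M) * d} with hBdef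
  have hB : MeasurableSet B := measurableSet_le (by fun_prop) measurable_const
  have hb := measureReal_card_lt_le hx hind hB fun i => by
    have := measureReal_lt_norm_sq_le hd hM (hx i) (hx4 i)
    simpa only [hBdef, Set.mem_ofPred_eq, not_le] using this
  set E := {ω | (2 * (Finset.univ.filter fun i => x i ω ∈ B).card : ℝ) < n} with hE
  have hEm : MeasurableSet E := by
    have e : ∀ ω, ((Finset.univ.filter fun i => x i ω ∈ B).card : ℝ)
        = ∑ i, B.indicator (fun _ => (1 : ℝ)) (x i ω) := fun ω => by
      simp [Set.indicator_apply]
    simp only [hE, e]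
    refine measurableSet_lt (Measurable.const_mul ?_ _) measurable_const
    exact Finset.measurable_fun_sum _ fun i _ =>
      (measurable_const.indicator hB).comp (hx i)
  have hc : μ.real Eᶜ = 1 - μ.real E := probReal_compl_eq_one_sub hEm
  calc _ ≤ μ.real Eᶜ := by rw [hc]; linarith
    _ ≤ _ := measureReal_mono fun ω hω => by
        rw [hE, Set.mem_compl_iff, Set.mem_ofPred_eq, not_lt] at hω
        rw [Set.mem_ofPred_eq]
        refine le_norm_gaussianKernelMatrix ha _ (Finset.univ.filter fun i => x i ω ∈ B)
          hω (r := 6 * (1 + M) * d) (fun i hi => (Finset.mem_filter.1 hi).2) ?_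
        linarith

/-- The kernel matrix has norm at most two as soon as all pairs of points are well separated. -/
theorem measureReal_two_le_norm_gaussianKernelMatrix_le {Ω : Type*} [MeasurableSpace Ω]
    {μ : Measure Ω} {n d : ℕ} {a r p : ℝ} (ha : 0 ≤ a) [IsFiniteMeasure μ]
    {x : Fin n → Ω → EuclideanSpace ℝ (Fin d)} (hp : 0 ≤ p)
    (hpair : ∀ i j, i ≠ j → μ.real {ω | ‖x i ω - x j ω‖ ^ 2 ≤ r} ≤ p)
    (har : Real.log n ≤ a * r) :
    μ.real {ω | 2 ≤ ‖gaussianKernelMatrix a (fun i => x i ω)‖} ≤ (n : ℝ) ^ 2 * p := by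
  set T : Finset (Fin n × Fin n) := Finset.univ.filter fun q => q.1 ≠ q.2 with hT
  have hsub : {ω | 2 ≤ ‖gaussianKernelMatrix a (fun i => x i ω)‖}
      ⊆ ⋃ q ∈ T, {ω | ‖x q.1 ω - x q.2 ω‖ ^ 2 ≤ r} := by
    intro ω hω
    rw [Set.mem_ofPred_eq] at hω
    by_contra hcon
    simp only [Set.mem_iUnion, not_exists, Set.mem_ofPred_eq, not_le] at hcon
    exact absurd hω (not_le.2 (norm_gaussianKernelMatrix_lt_two ha _
      (fun i j hij => (hcon (i, j) (by simp [hT, hij])).le) har))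
  calc _ ≤ _ := measureReal_mono hsub (measure_ne_top _ _)
    _ ≤ ∑ q ∈ T, μ.real {ω | ‖x q.1 ω - x q.2 ω‖ ^ 2 ≤ r} := measureReal_biUnion_finset_le _ _
    _ ≤ ∑ _q ∈ T, p := Finset.sum_le_sum fun q hq => hpair _ _ (Finset.mem_filter.1 hq).2
    _ ≤ ∑ _q : Fin n × Fin n, p :=
        Finset.sum_le_sum_of_subset_of_nonneg (Finset.subset_univ _) fun _ _ _ => hp
    _ = _ := by simp [pow_two]

theorem theorem2 :
    -- `ζ` depends on `δ` only; the other constants depend on the subgaussian constant `L` only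
    ∃ ζ : ℝ → ℝ, (∀ δ : ℝ, 0 < δ → 0 < ζ δ) ∧
    ∀ L : ℝ, 0 < L →
    ∃ c c₀ c₀' c₁ C₁ : ℝ, 0 < c ∧ 0 < c₀ ∧ 0 < c₀' ∧ 0 < c₁ ∧ 0 < C₁ ∧
    ∀ (n d : ℕ) (Ω : Type*) [MeasurableSpace Ω] (μ : Measure Ω) [IsProbabilityMeasure μ]
      (x : Fin n → Ω → EuclideanSpace ℝ (Fin d)),
      (∀ i, Measurable (x i)) →
      iIndepFun x μ →
      (∀ i, ∫ ω, x i ω ∂μ = 0) →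
      (∀ i, IsSubgaussianVectorWith L (x i) μ) →
      ∀ a : ℝ, 0 < a →
      -- (a)
      (∀ ω, ‖gaussianKernelMatrix a (fun i => x i ω)‖ ≤ n) ∧
      -- (b)
      (a < c₁ / d →
        1 - Real.exp (-c₀' * n) ≤
          μ.real {ω | c₀ * n ≤ ‖gaussianKernelMatrix a (fun i => x i ω)‖}) ∧
      -- (c)
      ((∀ i, iIndepFun (fun (k : Fin d) ω => x i ω k) μ) →
        (∀ i j, i ≠ j → (d : ℝ) ≤ ∫ ω, ‖x i ω - x j ω‖ ^ 2 ∂μ) →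
        (n : ℝ) ≤ Real.exp (C₁ * d) →
        ∀ δ : ℝ, 0 < δ → (2 + δ) * (Real.log n / d) ≤ a →
          μ.real {ω | 2 ≤ ‖gaussianKernelMatrix a (fun i => x i ω)‖} ≤
            Real.exp (-c * ζ δ ^ 2 * d)) := by
  -- A constant `ζ` suffices: separation `d / 2` works as soon as `a ≥ 2 * log n / d`, at a rate
  -- free of `δ`.
  refine ⟨fun _ => 1, fun _ _ => one_pos, fun L hL => ?_⟩
  obtain ⟨M, hM, hmom⟩ := exists_integral_pow_four_le hL
  -- `C₁` makes the union-bound factor `n ^ 2` cost at most half of the exponent `d / (128 * M)`;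
  -- the other half is `c`. In `c₁`, 24 is 6 from Markov times 4 from doubling the radius.
  refine ⟨1 / (256 * M), Real.exp (-1) / 2, Real.log (4 / 3), 1 / (24 * (1 + M)), 1 / (512 * M),
    by positivity, by positivity, Real.log_pos (by norm_num), by positivity, by positivity, ?_⟩
  intro n d Ω _ μ _ x hx hind _ hsub a ha
  have hx4 : ∀ i k, Integrable (fun ω => x i ω k ^ 4) μ ∧ ∫ ω, x i ω k ^ 4 ∂μ ≤ M := fun i k =>
    hmom μ (fun ω => x i ω k) (by have := hx i; fun_prop) ((hsub i).coord k)
  refine ⟨fun ω => norm_gaussianKernelMatrix_le ha.le _, fun had => ?_,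
    fun hcoord hdist hn δ hδ haδ => ?_⟩
  · rcases Nat.eq_zero_or_pos d with rfl | hd
    · simp only [Nat.cast_zero, div_zero] at had
      exact absurd had ha.le.not_gt
    have hd' : (0 : ℝ) < d := by exact_mod_cast hd
    have e : Real.exp (-Real.log (4 / 3) * n) = (3 / 4) ^ n := by
      rw [mul_comm, Real.exp_nat_mul, Real.exp_neg, Real.exp_log (by norm_num)]
      norm_num
    rw [e]
    refine measureReal_le_norm_gaussianKernelMatrix hd hM ha.le hx hind hx4 ?_
    rw [lt_div_iff₀ hd', lt_div_iff₀ (by positivity)] at had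
    linarith
  · rcases Nat.eq_zero_or_pos d with rfl | hd
    · simp only [Nat.cast_zero, mul_zero, Real.exp_zero]
      exact measureReal_le_one
    have hd' : (0 : ℝ) < d := by exact_mod_cast hd
    have hlog : 0 ≤ Real.log n := Real.log_natCast_nonneg n
    have har : Real.log n ≤ a * (d / 2) := by
      have h1 := mul_le_mul_of_nonneg_right haδ hd'.le
      rw [mul_assoc, div_mul_cancel₀ _ hd'.ne'] at h1
      nlinarith
    refine (measureReal_two_le_norm_gaussianKernelMatrix_le ha.le (Real.exp_pos _).le
      (fun i j hij => measureReal_norm_sub_sq_le hM (hx i) (hx j) (hind.indepFun hij) (hcoord i)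
        (hcoord j) (hx4 i) (hx4 j) (hdist i j hij)) har).trans ?_
    calc (n : ℝ) ^ 2 * Real.exp (-d / (128 * M))
        ≤ Real.exp (1 / (512 * M) * d) ^ 2 * Real.exp (-d / (128 * M)) := by gcongr
      _ = Real.exp (-(1 / (256 * M)) * 1 ^ 2 * d) := by
          rw [← Real.exp_nat_mul, ← Real.exp_add]
          congr 1
          field_simp
          norm_num
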